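/- Let $n\ge 1$ and $n<p<\infty$. Let ${\cal D}^{1,p}(\mathbb{R}^n)$ be the space of $u\in L^1_{\rm loc}(\mathbb{R}^n)$ whose weak gradient $Du$ lies in $L^p(\mathbb{R}^n)$, each $u$ being identified with its continuous representative, and let $\|Du\|_p=\left(\int_{\mathbb{R}^n}|Du|^p\,dx\right)^{1/p}$. Let $\rho$ be a signed Borel measure on $\mathbb{R}^n$ with compact support, $\rho(\mathbb{R}^n)=0$ and $\int_{\mathbb{R}^n}y\,d\rho(y)\neq 0$. Let ${\cal S}(n)$ be the set of similarity transformations $S(y)=\lambda Oy+z$ with $\lambda>0$, $O\in \mathrm{O}(n)$, $z\in\mathbb{R}^n$, let $S_\#\rho$ denote the push forward of $\rho$ under $S$, and put $$ [u]_\rho:=\sup_{S\in {\cal S}(n)}\left\{\frac{\left|\int_{\mathbb{R}^n}u(x)\,d\mu(x)\right|}{\left|\int_{\mathbb{R}^n}x\,d\mu(x)\right|^{1-n/p}}: \mu=S_\#\rho\right\},\qquad u\in {\cal D}^{1,p}(\mathbb{R}^n). $$ Let $C_*$ be the smallest constant $C$ such that $[u]_\rho\le C\|Du\|_p$ for all $u\in{\cal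 D}^{1,p}(\mathbb{R}^n)$, and call $u\in {\cal D}^{1,p}(\mathbb{R}^n)$ an extremal if $[u]_\rho=C_*\|Du\|_p$. Let $S\in{\cal S}(n)$ and $\mu=S_\#\rho$. (a) If $u,v$ are extremals with $$ [u]_\rho=\frac{\int_{\mathbb{R}^n}u(x)\,d\mu(x)}{\left|\int_{\mathbb{R}^n}x\,d\mu(x)\right|^{1-n/p}}>0 \quad\text{and}\quad [v]_\rho=\frac{\int_{\mathbb{R}^n}v(y)\,d\rho(y)}{\left|\int_{\mathbb{R}^n}y\,d\rho(y)\right|^{1-n/p}}>0, $$ then for all $y\in\mathbb{R}^n$ $$ v(y)=\frac{\int_{\mathbb{R}^n}v\,d\rho}{\int_{\mathbb{R}^n}u\,d\mu}\bigl(u(S(y))-u(S(0))\bigr)+v(0). $$ (b) If $u_1,u_2$ are extremals with $$ [u_i]_\rho=\frac{\left|\int_{\mathbb{R}^n}u_i(x)\,d\mu(x)\right|}{\left|\int_{\mathbb{R}^n}x\,d\mu(x)\right|^{1-n/p}}\quad(i=1,2) \quad\text{and}\quad \int_{\mathbb{R}^n}u_1\,d\mu=\int_{\mathbb{R}^n}u_2\,d\mu,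 $$ then $u_1-u_2$ is constant on $\mathbb{R}^n$. -/

import Mathlib

open MeasureTheory Set
open scoped ENNReal ContDiff

noncomputable section

/-- `ℝⁿ` with its Euclidean norm. -/
abbrev Rn (n : ℕ) : Type := EuclideanSpace ℝ (Fin n)

/-- `g` is the weak (distributional) gradient of `u` on `ℝⁿ`:
`∫ u ∇φ = - ∫ φ g` for every test function `φ ∈ C_c^∞(ℝⁿ)`. -/
def HasWeakGradient {n : ℕ} (u : Rn n → ℝ) (g : Rn n → Rn n) : Prop :=
  LocallyIntegrable u volume ∧ LocallyIntegrable g volume ∧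
    ∀ φ : Rn n → ℝ, ContDiff ℝ ∞ φ → HasCompactSupport φ →
      ∫ x, u x • gradient φ x = - ∫ x, φ x • g x

/-- Weak gradients are unique almost everywhere. -/
theorem HasWeakGradient.ae_eq {n : ℕ} {u : Rn n → ℝ} {g h : Rn n → Rn n}
    (hg : HasWeakGradient u g) (hh : HasWeakGradient u h) : g =ᵐ[volume] h := by
  refine ae_eq_of_integral_contDiff_smul_eq hg.2.1 hh.2.1 fun φ hφ hc => ?_
  have h1 := hg.2.2 φ hφ hc
  have h2 := hh.2.2 φ hφ hc
  exact neg_injective (h1.symm.trans h2)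

open Classical in
/-- The weak gradient `Du` (determined almost everywhere by `HasWeakGradient.ae_eq`);
the value `0` is used if there is none. -/
def weakGradient {n : ℕ} (u : Rn n → ℝ) : Rn n → Rn n :=
  if h : ∃ g, HasWeakGradient u g then Classical.choose h else 0

/-- `‖Du‖_p = (∫ |Du|^p dx)^{1/p}`, with `|·|` the Euclidean norm. -/
def gradNorm {n : ℕ} (p : ℝ) (u : Rn n → ℝ) : ℝ≥0∞ :=
  eLpNorm (weakGradient u) (ENNReal.ofReal p) volume

/-- The homogeneous Sobolev space `D^{1,p}(ℝⁿ)`, for `p > n`: locally integrable functions whose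
weak gradient exists and lies in `L^p`, each being identified with its continuous
representative. -/
def homSobolev (n : ℕ) (p : ℝ) : Set (Rn n → ℝ) :=
  {u | Continuous u ∧ ∃ g, HasWeakGradient u g ∧ MemLp g (ENNReal.ofReal p) volume}

/-- The similarity transformations `S(y) = λ O y + z` with `λ > 0`, `O ∈ O(n)`, `z ∈ ℝⁿ`. -/
def similarities (n : ℕ) : Set (Rn n → Rn n) :=
  {S | ∃ (l : ℝ) (O : Rn n ≃ₗᵢ[ℝ] Rn n) (z : Rn n), 0 < l ∧ ∀ y, S y = l • O y + z}

/-- The first moment `∫ x dμ(x) ∈ ℝⁿ` of a signed measure. -/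
def firstMoment {n : ℕ} (μ : SignedMeasure (Rn n)) : Rn n := ∫ᵛ x, x ∂<•μ

/-- The standing assumptions on the signed Borel measure `ρ`: compact support, total mass zero,
and nonzero first moment. -/
structure Admissible {n : ℕ} (ρ : SignedMeasure (Rn n)) : Prop where
  isCompact_support : IsCompact ρ.totalVariation.support
  mass_zero : ρ univ = 0
  firstMoment_ne_zero : firstMoment ρ ≠ 0

/-- The seminorm `[u]_ρ = sup { |∫ u dμ| / |∫ x dμ|^{1-n/p} : μ = S_# ρ, S a similarity }`. -/
def rhoSeminorm {n : ℕ} (p : ℝ) (ρ : SignedMeasure (Rn n)) (u : Rn n → ℝ) : ℝ≥0∞ :=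
  ⨆ S ∈ similarities n,
    ENNReal.ofReal (|∫ᵛ x, u x ∂•(ρ.map S)| / ‖firstMoment (ρ.map S)‖ ^ (1 - (n : ℝ) / p))

/-- The smallest constant `C` with `[u]_ρ ≤ C ‖Du‖_p` for all `u ∈ D^{1,p}(ℝⁿ)`. -/
def bestConstant {n : ℕ} (p : ℝ) (ρ : SignedMeasure (Rn n)) : ℝ≥0∞ :=
  sInf {C | ∀ u ∈ homSobolev n p, rhoSeminorm p ρ u ≤ C * gradNorm p u}

/-- `u ∈ D^{1,p}(ℝⁿ)` is an extremal of the generalized Morrey inequality: equality holds in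
`[u]_ρ ≤ C_* ‖Du‖_p` with the smallest constant `C_*`. -/
def IsExtremal {n : ℕ} (p : ℝ) (ρ : SignedMeasure (Rn n)) (u : Rn n → ℝ) : Prop :=
  u ∈ homSobolev n p ∧ rhoSeminorm p ρ u = bestConstant p ρ * gradNorm p u

end

/-! ### Weak gradients -/

section WeakGradient

variable {n : ℕ}

/-! Uniqueness comes from strict convexity of the `L^p` norm, similarity invariance does the rest.
If `u₁`, `u₂` attain the supremum at the same `μ` with equal integrals, then `‖Du₁‖ = ‖Du₂‖`, while
the inequality for `u₁ + u₂` gives `2‖Du₁‖ ≤ ‖Du₁ + Du₂‖`. Equality in Minkowski's inequality forces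
`Du₁ = Du₂` a.e. (`ae_eq_of_eLpNorm_add_ge`), so `u₁ - u₂` is constant
(`HasWeakGradient.eq_of_zero`). This is (b), proved in `exists_const_of_attained`; cancelling `C_*`
requires `bestConstant_ne_zero` and a separate look at `C_* = ∞`. For (a), composing with `S`
multiplies both `‖Du‖_p` and the power of the first moment by `λ^(1-n/p)`, and additive constants
are invisible to `ρ`. Hence some `c * (u ∘ S) + d` attains the supremum at `ρ` with the same
integral as `v`, and the uniqueness argument applies at `ρ`. -/

theorem hasCompactSupport_gradient {φ : Rn n → ℝ} (hφ : HasCompactSupport φ) :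
    HasCompactSupport (gradient φ) := by
  have h := hφ.fderiv ℝ
  exact h.comp_left (g := (InnerProductSpace.toDual ℝ (Rn n)).symm) (map_zero _)

theorem continuous_gradient {φ : Rn n → ℝ} (hφ : ContDiff ℝ 1 φ) :
    Continuous (gradient φ) :=
  (InnerProductSpace.toDual ℝ (Rn n)).symm.continuous.comp (hφ.continuous_fderiv one_ne_zero)

theorem integrable_smul_gradient {u : Rn n → ℝ} (hu : LocallyIntegrable u volume)
    {φ : Rn n → ℝ} (hφ : ContDiff ℝ ∞ φ) (hc : HasCompactSupport φ) :
    Integrable (fun x => u x • gradient φ x) :=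
  hu.integrable_smul_right_of_hasCompactSupport
    (continuous_gradient (hφ.of_le (by simp))) (hasCompactSupport_gradient hc)

theorem HasWeakGradient.add {u v : Rn n → ℝ} {g h : Rn n → Rn n}
    (hu : HasWeakGradient u g) (hv : HasWeakGradient v h) :
    HasWeakGradient (fun x => u x + v x) (fun x => g x + h x) := by
  refine ⟨hu.1.add hv.1, hu.2.1.add hv.2.1, fun φ hφ hc => ?_⟩
  simp_rw [add_smul, smul_add]
  rw [integral_add (integrable_smul_gradient hu.1 hφ hc) (integrable_smul_gradient hv.1 hφ hc),
    integral_add (hu.2.1.integrable_smul_left_of_hasCompactSupport hφ.continuous hc)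
      (hv.2.1.integrable_smul_left_of_hasCompactSupport hφ.continuous hc),
    hu.2.2 φ hφ hc, hv.2.2 φ hφ hc, neg_add]

theorem HasWeakGradient.const_mul {u : Rn n → ℝ} {g : Rn n → Rn n}
    (hu : HasWeakGradient u g) (c : ℝ) :
    HasWeakGradient (fun x => c * u x) (fun x => c • g x) := by
  refine ⟨hu.1.smul c, hu.2.1.smul c, fun φ hφ hc => ?_⟩
  simp_rw [mul_smul, smul_comm _ c]
  rw [integral_smul, integral_smul, hu.2.2 φ hφ hc, smul_neg]

theorem HasWeakGradient.sub {u v : Rn n → ℝ} {g h : Rn n → Rn n}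
    (hu : HasWeakGradient u g) (hv : HasWeakGradient v h) :
    HasWeakGradient (fun x => u x - v x) (fun x => g x - h x) := by
  simpa [sub_eq_add_neg] using hu.add (hv.const_mul (-1))

theorem HasWeakGradient.congr_ae {u : Rn n → ℝ} {g h : Rn n → Rn n}
    (hu : HasWeakGradient u g) (hgh : g =ᵐ[volume] h) : HasWeakGradient u h := by
  refine ⟨hu.1, hu.2.1.congr hgh, fun φ hφ hc => ?_⟩
  rw [hu.2.2 φ hφ hc]
  congr 1
  exact integral_congr_ae (hgh.mono fun x hx => by simp [hx])

/-- The classical gradient of a continuously differentiable function is a weak gradient. -/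
theorem hasWeakGradient_gradient {u : Rn n → ℝ} (hu : ContDiff ℝ 1 u) :
    HasWeakGradient u (gradient u) := by
  have hg := continuous_gradient hu
  refine ⟨hu.continuous.locallyIntegrable, hg.locallyIntegrable, fun φ hφ hc => ?_⟩
  have hφ1 : ContDiff ℝ 1 φ := hφ.of_le (by simp)
  have h1 := integrable_smul_gradient hu.continuous.locallyIntegrable hφ hc
  have h2 : Integrable (fun x => φ x • gradient u x) :=
    hg.locallyIntegrable.integrable_smul_left_of_hasCompactSupport hφ.continuous hc
  -- Pairing with a fixed vector reduces the claim to scalar integration by parts.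
  refine ext_inner_right ℝ fun v => ?_
  rw [inner_neg_left, real_inner_comm, ← integral_inner h1, real_inner_comm v,
    ← integral_inner h2]
  simp_rw [inner_smul_right, real_inner_comm _ v, inner_gradient_left]
  have h := integral_mul_fderiv_eq_neg_fderiv_mul_of_integrable (μ := volume) (f := u) (g := φ)
    (v := v) ?_ ?_ ?_ (fun x _ => hu.differentiable one_ne_zero x)
    (fun x _ => hφ1.differentiable one_ne_zero x)
  · rw [h]; simp_rw [mul_comm]
  · simpa [inner_smul_right, inner_gradient_right, mul_comm]
      using h2.const_inner (𝕜 := ℝ) v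
  · simpa [inner_smul_right, inner_gradient_right]
      using h1.const_inner (𝕜 := ℝ) v
  · exact (hu.continuous.mul hφ.continuous).integrable_of_hasCompactSupport hc.mul_left

theorem hasWeakGradient_const (c : ℝ) :
    HasWeakGradient (fun _ : Rn n => c) (fun _ => 0) := by
  simpa [gradient_fun_const'] using
    hasWeakGradient_gradient (u := fun _ : Rn n => c) contDiff_const

/-- A continuous function with vanishing weak gradient is constant. -/
theorem HasWeakGradient.eq_of_zero {u : Rn n → ℝ} (hc : Continuous u)
    (hu : HasWeakGradient u (fun _ => 0)) (x y : Rn n) : u x = u y := by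
  -- Mollify: the convolutions with shrinking bumps converge pointwise to `u`, so it suffices that
  -- each one is constant.
  let φ : ℕ → ContDiffBump (0 : Rn n) := fun k =>
    ⟨1 / (2 * (k + 1)), 1 / (k + 1), by positivity, by
      rw [div_lt_div_iff₀ (by positivity) (by positivity)]
      nlinarith [(Nat.cast_nonneg k : (0 : ℝ) ≤ k)]⟩
  have hφ : Filter.Tendsto (fun k => (φ k).rOut) Filter.atTop (nhds 0) :=
    tendsto_one_div_add_atTop_nhds_zero_nat
  have ht := ContDiffBump.convolution_tendsto_right_of_continuous (μ := volume) hφ hc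
  refine tendsto_nhds_unique (ht x) ((ht y).congr fun k => ?_)
  set ψ := (φ k).normed volume
  have hψ : ContDiff ℝ ∞ ψ := (φ k).contDiff_normed
  have hψc : HasCompactSupport ψ := (φ k).hasCompactSupport_normed
  have hψ1 : ContDiff ℝ 1 ψ := hψ.of_le (by simp)
  have hd := fun z => hψc.hasFDerivAt_convolution_left (μ := volume)
    (ContinuousLinearMap.lsmul ℝ ℝ) hψ1 hc.locallyIntegrable z
  refine is_const_of_fderiv_eq_zero (𝕜 := ℝ) (fun z => (hd z).differentiableAt) (fun z => ?_) y x
  rw [(hd z).fderiv, convolution_eq_swap]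
  have hcs : HasCompactSupport fun t => ψ (z - t) :=
    hψc.comp_homeomorph (Homeomorph.subLeft z)
  have hsm : ContDiff ℝ ∞ fun t => ψ (z - t) := hψ.comp (contDiff_const.sub contDiff_id)
  -- The derivative of the mollification at `z` is, up to sign, the weak gradient identity tested on
  -- `t ↦ ψ (z - t)`, hence zero.
  have key := hu.2.2 _ hsm hcs
  simp only [smul_zero, integral_zero, neg_zero] at key
  have hfd : ∀ t, fderiv ℝ (fun t => ψ (z - t)) t = - fderiv ℝ ψ (z - t) := fun t => by
    have := (hψ1.differentiable one_ne_zero (z - t)).hasFDerivAt.comp t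
      ((hasFDerivAt_id t).const_sub z)
    exact (HasFDerivAt.congr_fderiv this (by ext v; simp)).fderiv
  have hint : Integrable fun t =>
      (((ContinuousLinearMap.lsmul ℝ ℝ).precompL (Rn n)) (fderiv ℝ ψ (z - t))) (u t) := by
    refine Continuous.integrable_of_hasCompactSupport ?_ ?_
    · have := hψ1.continuous_fderiv one_ne_zero
      fun_prop
    · refine ((hψc.fderiv ℝ).comp_homeomorph (Homeomorph.subLeft z)).mono' ?_
      refine fun t ht => subset_closure ?_
      contrapose! ht
      simp only [Function.mem_support, Function.comp_apply, Homeomorph.coe_subLeft,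
        not_not] at ht ⊢
      simp [ht]
  ext v
  rw [ContinuousLinearMap.integral_apply hint]
  have h2 := congrArg (fun w => inner ℝ v w) key
  simp only [inner_zero_right] at h2
  rw [← integral_inner (integrable_smul_gradient hu.1 hsm hcs)] at h2
  simp_rw [inner_smul_right, real_inner_comm _ v, inner_gradient_left, hfd] at h2
  simp only [FunLike.coe_neg, Pi.neg_apply, mul_neg, integral_neg, neg_eq_zero] at h2
  simpa [ContinuousLinearMap.precompL_apply, mul_comm] using h2

theorem exists_const_of_hasWeakGradient {u v : Rn n → ℝ} {g h : Rn n → Rn n}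
    (hu : Continuous u) (hv : Continuous v) (hug : HasWeakGradient u g)
    (hvh : HasWeakGradient v h) (hgh : g =ᵐ[volume] h) : ∃ c : ℝ, ∀ x, u x - v x = c := by
  have := (hug.sub hvh).congr_ae (h := fun _ => 0) (hgh.mono fun x hx => by simp [hx])
  exact ⟨u 0 - v 0, fun x => this.eq_of_zero (hu.sub hv) x 0⟩

/-- Uniqueness a.e. makes the norm independent of the gradient selected by choice. -/
theorem gradNorm_eq {p : ℝ} {u : Rn n → ℝ} {g : Rn n → Rn n} (hu : HasWeakGradient u g) :
    gradNorm p u = eLpNorm g (ENNReal.ofReal p) volume := by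
  have h : ∃ g, HasWeakGradient u g := ⟨g, hu⟩
  unfold gradNorm weakGradient
  rw [dif_pos h]
  exact eLpNorm_congr_ae ((Classical.choose_spec h).ae_eq hu)

theorem gradNorm_ne_top {p : ℝ} {u : Rn n → ℝ} (hu : u ∈ homSobolev n p) :
    gradNorm p u ≠ ⊤ := by
  obtain ⟨_, g, hg, hgp⟩ := hu
  rw [gradNorm_eq hg]
  exact hgp.2.ne

end WeakGradient

/-! ### Similarity transformations -/

section Similarity

variable {n : ℕ}

/-- The similarity `y ↦ l O y + z` as a homeomorphism. -/
noncomputable def similarityHomeomorph (l : ℝ) (hl : l ≠ 0) (O : Rn n ≃ₗᵢ[ℝ] Rn n) (z : Rn n) :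
    Rn n ≃ₜ Rn n :=
  (O.toHomeomorph.trans (Homeomorph.smulOfNeZero l hl)).trans (Homeomorph.addRight z)

theorem similarityHomeomorph_apply (l : ℝ) (hl : l ≠ 0) (O : Rn n ≃ₗᵢ[ℝ] Rn n) (z y : Rn n) :
    similarityHomeomorph l hl O z y = l • O y + z := rfl

theorem similarityHomeomorph_symm_apply (l : ℝ) (hl : l ≠ 0) (O : Rn n ≃ₗᵢ[ℝ] Rn n)
    (z y : Rn n) : (similarityHomeomorph l hl O z).symm y = O.symm (l⁻¹ • (y - z)) := by
  rw [Homeomorph.symm_apply_eq, similarityHomeomorph_apply]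
  simp [smul_smul, hl]

theorem exists_similarityHomeomorph {S : Rn n → Rn n} (hS : S ∈ similarities n) :
    ∃ (l : ℝ) (hl : 0 < l) (O : Rn n ≃ₗᵢ[ℝ] Rn n) (z : Rn n),
      S = similarityHomeomorph l hl.ne' O z := by
  obtain ⟨l, O, z, hl, h⟩ := hS
  exact ⟨l, hl, O, z, funext h⟩

theorem map_similarityHomeomorph_volume {l : ℝ} (hl : 0 < l) (O : Rn n ≃ₗᵢ[ℝ] Rn n) (z : Rn n) :
    Measure.map (similarityHomeomorph l hl.ne' O z) volume =
      ENNReal.ofReal (l ^ n)⁻¹ • (volume : Measure (Rn n)) := by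
  have h : (similarityHomeomorph l hl.ne' O z : Rn n → Rn n) =
      (fun x => x + z) ∘ (fun x => l • x) ∘ O := rfl
  rw [h, ← Measure.map_map (by fun_prop) (by fun_prop),
    ← Measure.map_map (by fun_prop) O.continuous.measurable, O.measurePreserving.map_eq,
    Measure.map_addHaar_smul _ hl.ne', Measure.map_smul, map_add_right_eq_self]
  simp [abs_of_pos hl]

theorem locallyIntegrable_comp_similarityHomeomorph {E : Type*} [NormedAddCommGroup E]
    {l : ℝ} (hl : 0 < l) (O : Rn n ≃ₗᵢ[ℝ] Rn n) (z : Rn n) {f : Rn n → E}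
    (hf : LocallyIntegrable f volume) :
    LocallyIntegrable (fun y => f (similarityHomeomorph l hl.ne' O z y)) volume := by
  refine (locallyIntegrable_map_homeomorph _).1 ?_
  rw [map_similarityHomeomorph_volume hl]
  intro x
  obtain ⟨s, hs, h⟩ := hf x
  refine ⟨s, hs, ?_⟩
  rw [IntegrableOn, Measure.restrict_smul]
  exact Integrable.smul_measure h ENNReal.ofReal_ne_top

theorem integral_comp_similarityHomeomorph {E : Type*} [NormedAddCommGroup E] [NormedSpace ℝ E]
    {l : ℝ} (hl : 0 < l) (O : Rn n ≃ₗᵢ[ℝ] Rn n) (z : Rn n) (f : Rn n → E) :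
    ∫ y, f (similarityHomeomorph l hl.ne' O z y) = (l ^ n)⁻¹ • ∫ x, f x := by
  rw [← (similarityHomeomorph l hl.ne' O z).measurableEmbedding.integral_map,
    map_similarityHomeomorph_volume hl, integral_smul_measure,
    ENNReal.toReal_ofReal (by positivity)]

theorem gradient_comp_similarityHomeomorph {l : ℝ} (hl : 0 < l) (O : Rn n ≃ₗᵢ[ℝ] Rn n)
    (z : Rn n) {ψ : Rn n → ℝ} (hψ : Differentiable ℝ ψ) (y : Rn n) :
    gradient (fun y => ψ (similarityHomeomorph l hl.ne' O z y)) y =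
      l • O.symm (gradient ψ (similarityHomeomorph l hl.ne' O z y)) := by
  have h1 : HasFDerivAt (similarityHomeomorph l hl.ne' O z : Rn n → Rn n)
      (l • (O.toContinuousLinearEquiv : Rn n →L[ℝ] Rn n)) y :=
    (O.toContinuousLinearEquiv.hasFDerivAt.const_smul l).add_const z
  have h2 := (hψ (similarityHomeomorph l hl.ne' O z y)).hasFDerivAt.comp y h1
  refine ext_inner_right ℝ fun v => ?_
  rw [inner_gradient_left]
  have h3 : fderiv ℝ (fun y => ψ (similarityHomeomorph l hl.ne' O z y)) y = _ := h2.fderiv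
  rw [h3, inner_smul_left, LinearIsometryEquiv.inner_map_eq_flip, LinearIsometryEquiv.symm_symm,
    inner_gradient_left]
  simp

theorem contDiff_similarityHomeomorph_symm {l : ℝ} (hl : l ≠ 0) (O : Rn n ≃ₗᵢ[ℝ] Rn n)
    (z : Rn n) {k : ℕ∞ω} : ContDiff ℝ k (similarityHomeomorph l hl O z).symm := by
  rw [funext (similarityHomeomorph_symm_apply l hl O z)]
  exact O.symm.contDiff.comp ((contDiff_id.sub contDiff_const).const_smul _)

theorem HasWeakGradient.comp_similarityHomeomorph {u : Rn n → ℝ} {g : Rn n → Rn n}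
    (hu : HasWeakGradient u g) {l : ℝ} (hl : 0 < l) (O : Rn n ≃ₗᵢ[ℝ] Rn n) (z : Rn n) :
    HasWeakGradient (fun y => u (similarityHomeomorph l hl.ne' O z y))
      (fun y => l • O.symm (g (similarityHomeomorph l hl.ne' O z y))) := by
  set S := similarityHomeomorph l hl.ne' O z with hSdef
  have hg := locallyIntegrable_comp_similarityHomeomorph hl O z hu.2.1
  refine ⟨locallyIntegrable_comp_similarityHomeomorph hl O z hu.1, ?_, fun φ hφ hc => ?_⟩
  · refine LocallyIntegrable.smul (fun x => ?_) l
    obtain ⟨s, hs, h⟩ := hg x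
    exact ⟨s, hs, O.symm.toContinuousLinearEquiv.toContinuousLinearMap.integrable_comp h⟩
  -- Transporting the test function by `S` reduces to the identity for `u`; both sides acquire the
  -- same Jacobian factor.
  · set ψ : Rn n → ℝ := φ ∘ S.symm with hψdef
    have hψ : ContDiff ℝ ∞ ψ := hφ.comp (contDiff_similarityHomeomorph_symm _ O z)
    have hψc : HasCompactSupport ψ := hc.comp_homeomorph S.symm
    have hφψ : φ = fun y => ψ (S y) := by ext y; simp [hψdef]
    have hgr : ∀ y, gradient φ y = l • O.symm (gradient ψ (S y)) := fun y => by
      conv_lhs => rw [hφψ]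
      exact gradient_comp_similarityHomeomorph hl O z (hψ.differentiable (by simp)) y
    have h1 : ∀ y, u (S y) • gradient φ y = l • O.symm (u (S y) • gradient ψ (S y)) :=
      fun y => by rw [hgr, map_smul, smul_comm]
    have h2 : ∀ y, φ y • l • O.symm (g (S y)) = l • O.symm (ψ (S y) • g (S y)) :=
      fun y => by rw [map_smul, smul_comm]; simp [hψdef]
    have hO : ∀ F : Rn n → Rn n, ∫ y, O.symm (F y) = O.symm (∫ y, F y) := fun F =>
      O.symm.toContinuousLinearEquiv.integral_comp_comm F
    simp_rw [h1, h2]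
    rw [integral_smul, integral_smul, hO, hO,
      integral_comp_similarityHomeomorph hl O z (fun x => u x • gradient ψ x),
      integral_comp_similarityHomeomorph hl O z (fun x => ψ x • g x), hu.2.2 ψ hψ hψc]
    simp

/-- The chain rule contributes `l` and the change of variables `l^(-n/p)`. The resulting exponent is
the one on the first moment in the seminorm. -/
theorem eLpNorm_comp_similarityHomeomorph {p : ℝ} (hp : 0 < p) {g : Rn n → Rn n}
    (hg : AEStronglyMeasurable g volume) {l : ℝ} (hl : 0 < l) (O : Rn n ≃ₗᵢ[ℝ] Rn n)
    (z : Rn n) :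
    eLpNorm (fun y => l • O.symm (g (similarityHomeomorph l hl.ne' O z y))) (ENNReal.ofReal p)
      volume = ENNReal.ofReal (l ^ (1 - (n : ℝ) / p)) * eLpNorm g (ENNReal.ofReal p) volume := by
  set S := similarityHomeomorph l hl.ne' O z
  have h1 : eLpNorm (fun y => l • O.symm (g (S y))) (ENNReal.ofReal p) volume =
      eLpNorm (l • (g ∘ S)) (ENNReal.ofReal p) volume :=
    eLpNorm_congr_norm_ae (Filter.Eventually.of_forall fun y => by simp [norm_smul])
  have hmap := map_similarityHomeomorph_volume hl O z
  rw [h1, eLpNorm_const_smul, ← eLpNorm_map_measure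
    (by rw [hmap]; exact hg.smul_measure _) S.continuous.aemeasurable, hmap,
    eLpNorm_smul_measure_of_ne_top ENNReal.ofReal_ne_top, smul_eq_mul, ← mul_assoc]
  congr 1
  rw [Real.enorm_eq_ofReal hl.le, one_div, ENNReal.toReal_inv, ENNReal.toReal_ofReal hp.le,
    ENNReal.ofReal_rpow_of_nonneg (by positivity) (by positivity), ← ENNReal.ofReal_mul hl.le]
  congr 1
  rw [Real.rpow_sub hl, Real.rpow_one, Real.inv_rpow (by positivity), ← Real.rpow_natCast,
    ← Real.rpow_mul hl.le]
  rfl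

theorem homSobolev_comp_similarityHomeomorph {p : ℝ} (hp : 0 < p) {u : Rn n → ℝ}
    (hu : u ∈ homSobolev n p) {l : ℝ} (hl : 0 < l) (O : Rn n ≃ₗᵢ[ℝ] Rn n) (z : Rn n) :
    (fun y => u (similarityHomeomorph l hl.ne' O z y)) ∈ homSobolev n p ∧
      gradNorm p (fun y => u (similarityHomeomorph l hl.ne' O z y)) =
        ENNReal.ofReal (l ^ (1 - (n : ℝ) / p)) * gradNorm p u := by
  obtain ⟨hc, g, hg, hgp⟩ := hu
  have h1 := hg.comp_similarityHomeomorph hl O z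
  have h2 := eLpNorm_comp_similarityHomeomorph hp hgp.1 hl O z
  refine ⟨⟨hc.comp (Homeomorph.continuous _), _, h1, h1.2.1.aestronglyMeasurable, ?_⟩, ?_⟩
  · rw [h2]
    exact ENNReal.mul_lt_top ENNReal.ofReal_lt_top hgp.2
  · rw [gradNorm_eq h1, h2, gradNorm_eq hg]

/-- Affine rescaling `c * u + d` of a function of the homogeneous Sobolev space. -/
theorem homSobolev_affine {p : ℝ} {u : Rn n → ℝ} (hu : u ∈ homSobolev n p) {c : ℝ} (hc : 0 ≤ c)
    (d : ℝ) : (fun y => c * u y + d) ∈ homSobolev n p ∧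
      gradNorm p (fun y => c * u y + d) = ENNReal.ofReal c * gradNorm p u := by
  obtain ⟨hcont, g, hg, hgp⟩ := hu
  have h1 : HasWeakGradient (fun y => c * u y + d) (fun y => c • g y) := by
    simpa using (hg.const_mul c).add (hasWeakGradient_const d)
  refine ⟨⟨(hcont.const_mul c).add_const d, _, h1, hgp.const_smul c⟩, ?_⟩
  rw [gradNorm_eq h1, gradNorm_eq hg, ← Real.enorm_eq_ofReal hc]
  exact eLpNorm_const_smul c g _ _

end Similarity

/-! ### Strict convexity of the `L^p` norm -/

/-- Triangle inequality followed by midpoint convexity of `t ↦ t^p`. -/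
theorem norm_add_rpow_le {E : Type*} [NormedAddCommGroup E] {p : ℝ}
    (hp : 1 < p) (a b : E) :
    ‖a + b‖ ^ p ≤ 2 ^ p * ((‖a‖ ^ p + ‖b‖ ^ p) / 2) := by
  have h := (convexOn_rpow hp.le).2 (norm_nonneg a) (norm_nonneg b)
    (by norm_num : (0 : ℝ) ≤ 1 / 2) (by norm_num : (0 : ℝ) ≤ 1 / 2) (by norm_num)
  simp only [smul_eq_mul] at h
  calc ‖a + b‖ ^ p ≤ (2 * (1 / 2 * ‖a‖ + 1 / 2 * ‖b‖)) ^ p := by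
        gcongr
        linarith [norm_add_le a b]
    _ = 2 ^ p * (1 / 2 * ‖a‖ + 1 / 2 * ‖b‖) ^ p := by
        rw [Real.mul_rpow (by norm_num) (by positivity)]
    _ ≤ _ := by gcongr; linarith

/-- Strict convexity of `t ↦ t^p` forces equal norms; equality in the triangle inequality then puts
both vectors on one ray. -/
theorem eq_of_norm_add_rpow_eq {E : Type*} [NormedAddCommGroup E] [InnerProductSpace ℝ E] {p : ℝ}
    (hp : 1 < p) {a b : E} (h : ‖a + b‖ ^ p = 2 ^ p * ((‖a‖ ^ p + ‖b‖ ^ p) / 2)) : a = b := by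
  have h2 : ‖a + b‖ ^ p ≤ 2 ^ p * (1 / 2 * ‖a‖ + 1 / 2 * ‖b‖) ^ p := by
    rw [← Real.mul_rpow (by norm_num) (by positivity)]
    gcongr
    linarith [norm_add_le a b]
  have h2p : (0 : ℝ) < 2 ^ p := by positivity
  have hab : ‖a‖ = ‖b‖ := by
    by_contra hne
    have h3 := (strictConvexOn_rpow hp).2 (norm_nonneg a) (norm_nonneg b) hne
      (by norm_num : (0 : ℝ) < 1 / 2) (by norm_num : (0 : ℝ) < 1 / 2) (by norm_num)
    simp only [smul_eq_mul] at h3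
    have := mul_lt_mul_of_pos_left h3 h2p
    rw [h] at h2
    linarith
  have hsum : ‖a + b‖ = ‖a‖ + ‖b‖ := by
    refine Real.rpow_left_injOn (by linarith : p ≠ 0) (norm_nonneg (a + b))
      (by positivity : 0 ≤ ‖a‖ + ‖b‖) ?_
    simp only
    rw [h, hab, ← two_mul ‖b‖, Real.mul_rpow (by norm_num) (norm_nonneg b)]
    ring
  exact ((sameRay_iff_norm_add.2 hsum).norm_eq_iff).1 hab

/-- If the sum of two `L^p` functions of the same norm has twice their norm, the functions agree
almost everywhere, for `1 < p < ∞`. -/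
theorem ae_eq_of_eLpNorm_add_ge {α E : Type*} {m : MeasurableSpace α} {μ : Measure α}
    [NormedAddCommGroup E] [InnerProductSpace ℝ E] {p : ℝ} (hp : 1 < p) {g h : α → E}
    (hg : MemLp g (ENNReal.ofReal p) μ) (hh : MemLp h (ENNReal.ofReal p) μ)
    (heq : eLpNorm g (ENNReal.ofReal p) μ = eLpNorm h (ENNReal.ofReal p) μ)
    (hge : 2 * eLpNorm g (ENNReal.ofReal p) μ ≤
      eLpNorm (fun x => g x + h x) (ENNReal.ofReal p) μ) : g =ᵐ[μ] h := by
  have hp0 : 0 < p := by linarith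
  have h0 : ENNReal.ofReal p ≠ 0 := by simpa using hp0
  have ht : ENNReal.ofReal p ≠ ⊤ := ENNReal.ofReal_ne_top
  have hs : MemLp (fun x => g x + h x) (ENNReal.ofReal p) μ := hg.add hh
  have hr : (ENNReal.ofReal p).toReal = p := ENNReal.toReal_ofReal hp0.le
  have ig := hg.integrable_norm_rpow h0 ht
  have ih := hh.integrable_norm_rpow h0 ht
  have is := hs.integrable_norm_rpow h0 ht
  rw [hg.eLpNorm_eq_integral_rpow_norm h0 ht] at heq hge
  rw [hh.eLpNorm_eq_integral_rpow_norm h0 ht] at heq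
  rw [hs.eLpNorm_eq_integral_rpow_norm h0 ht] at hge
  rw [hr] at ig ih is heq hge
  set A := ∫ x, ‖g x‖ ^ p ∂μ
  set B := ∫ x, ‖h x‖ ^ p ∂μ
  set C := ∫ x, ‖g x + h x‖ ^ p ∂μ
  have hA : 0 ≤ A := integral_nonneg fun x => by positivity
  have hB : 0 ≤ B := integral_nonneg fun x => by positivity
  have hC : 0 ≤ C := integral_nonneg fun x => by positivity
  have hAB : A = B := by
    rw [ENNReal.ofReal_eq_ofReal_iff (by positivity) (by positivity)] at heq
    exact Real.rpow_left_injOn (by positivity : p⁻¹ ≠ 0) hA hB heq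
  have hAC : 2 ^ p * A ≤ C := by
    rw [← ENNReal.ofReal_ofNat 2, ← ENNReal.ofReal_mul (by norm_num),
      ENNReal.ofReal_le_ofReal_iff (by positivity)] at hge
    have := Real.rpow_le_rpow (by positivity) hge hp0.le
    rwa [Real.mul_rpow (by norm_num) (by positivity), Real.rpow_inv_rpow hA hp0.ne',
      Real.rpow_inv_rpow hC hp0.ne'] at this
  have iD : Integrable (fun x => 2 ^ p * ((‖g x‖ ^ p + ‖h x‖ ^ p) / 2)) μ :=
    ((ig.add ih).div_const 2).const_mul _
  have hD : ∫ x, (2 ^ p * ((‖g x‖ ^ p + ‖h x‖ ^ p) / 2) - ‖g x + h x‖ ^ p) ∂μ =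
      2 ^ p * ((A + B) / 2) - C := by
    rw [integral_sub iD is, integral_const_mul, integral_div, integral_add ig ih]
  -- The convexity defect is pointwise nonnegative with integral at most zero, so it vanishes a.e.
  have hnn : ∀ x, 0 ≤ 2 ^ p * ((‖g x‖ ^ p + ‖h x‖ ^ p) / 2) - ‖g x + h x‖ ^ p := fun x =>
    sub_nonneg.2 (norm_add_rpow_le hp _ _)
  have hz : ∫ x, (2 ^ p * ((‖g x‖ ^ p + ‖h x‖ ^ p) / 2) - ‖g x + h x‖ ^ p) ∂μ = 0 := by
    refine le_antisymm ?_ (integral_nonneg hnn)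
    rw [hD, ← hAB]
    linarith
  rw [integral_eq_zero_iff_of_nonneg hnn (iD.sub is)] at hz
  filter_upwards [hz] with x hx
  exact eq_of_norm_add_rpow_eq hp (sub_eq_zero.1 hx).symm

/-! ### Integrals with respect to an admissible signed measure -/

section SignedIntegral

variable {n : ℕ} {ρ : SignedMeasure (Rn n)}

instance isFiniteMeasure_variation_signedMeasure {X : Type*} [MeasurableSpace X]
    (ν : SignedMeasure X) : IsFiniteMeasure ν.variation := by
  rw [← SignedMeasure.totalVariation_eq_variation]; infer_instance

theorem ae_mem_support_totalVariation (ρ : SignedMeasure (Rn n)) :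
    ∀ᵐ x ∂ρ.variation, x ∈ ρ.totalVariation.support := by
  rw [← SignedMeasure.totalVariation_eq_variation]
  exact Measure.support_mem_ae

theorem Admissible.integrable (hρ : Admissible ρ) {E : Type*} [NormedAddCommGroup E]
    {f : Rn n → E} (hf : Continuous f) : Integrable f ρ.variation := by
  rw [← Measure.restrict_eq_self_of_ae_mem (ae_mem_support_totalVariation ρ)]
  exact hf.continuousOn.integrableOn_compact hρ.isCompact_support

/-- The vector valued integral against a signed measure in terms of its Jordan decomposition. -/
theorem integral_signedMeasure_eq_sub {X E : Type*} [MeasurableSpace X] [NormedAddCommGroup E]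
    [NormedSpace ℝ E] [CompleteSpace E] (ν : SignedMeasure X) {f : X → E}
    (hf : Integrable f ν.variation) :
    ∫ᵛ x, f x ∂<•ν = ∫ x, f x ∂ν.toJordanDecomposition.posPart -
      ∫ x, f x ∂ν.toJordanDecomposition.negPart := by
  rw [← SignedMeasure.totalVariation_eq_variation, SignedMeasure.totalVariation,
    integrable_add_measure] at hf
  conv_lhs => rw [← SignedMeasure.toSignedMeasure_toJordanDecomposition ν]
  rw [JordanDecomposition.toSignedMeasure, VectorMeasure.integral_sub_vectorMeasure,
    VectorMeasure.integral_toSignedMeasure, VectorMeasure.integral_toSignedMeasure]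
  · rw [VectorMeasure.Integrable, Measure.variation_toSignedMeasure]; exact hf.1
  · rw [VectorMeasure.Integrable, Measure.variation_toSignedMeasure]; exact hf.2

theorem integral_clm_comp_signedMeasure {X E F : Type*} [MeasurableSpace X]
    [NormedAddCommGroup E] [NormedSpace ℝ E] [CompleteSpace E] [NormedAddCommGroup F]
    [NormedSpace ℝ F] [CompleteSpace F] (ν : SignedMeasure X) {f : X → E}
    (hf : Integrable f ν.variation) (L : E →L[ℝ] F) :
    ∫ᵛ x, L (f x) ∂<•ν = L (∫ᵛ x, f x ∂<•ν) := by
  have hf' := hf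
  rw [← SignedMeasure.totalVariation_eq_variation, SignedMeasure.totalVariation,
    integrable_add_measure] at hf'
  rw [integral_signedMeasure_eq_sub ν hf, integral_signedMeasure_eq_sub ν (L.integrable_comp hf),
    L.integral_comp_comm hf'.1, L.integral_comp_comm hf'.2, map_sub]

/-- Links the pairing used for the first moment to the one used for `∫ u dμ`. -/
theorem integral_smul_flip_eq {X : Type*} [MeasurableSpace X] (ν : SignedMeasure X) (f : X → ℝ) :
    ∫ᵛ x, f x ∂<•ν = ∫ᵛ x, f x ∂•ν := by
  congr 1
  ext
  simp

/-- The translation part drops out because `ρ` has total mass zero. -/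
theorem firstMoment_map (hρ : Admissible ρ) {l : ℝ} (hl : 0 < l)
    (O : Rn n ≃ₗᵢ[ℝ] Rn n) (z : Rn n) :
    firstMoment (ρ.map (similarityHomeomorph l hl.ne' O z)) = l • O (firstMoment ρ) := by
  rw [firstMoment, (Homeomorph.measurableEmbedding _).integral_map_vectorMeasure]
  simp_rw [similarityHomeomorph_apply]
  rw [VectorMeasure.integral_fun_add (hρ.integrable (by fun_prop)) (hρ.integrable (by fun_prop)),
    VectorMeasure.integral_const, VectorMeasure.integral_fun_smul, hρ.mass_zero, map_zero,
    add_zero]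
  exact congrArg (l • ·) (integral_clm_comp_signedMeasure ρ (f := fun x => x)
    (hρ.integrable continuous_id) (O.toContinuousLinearEquiv : Rn n →L[ℝ] Rn n))

theorem norm_firstMoment_map (hρ : Admissible ρ) {l : ℝ} (hl : 0 < l)
    (O : Rn n ≃ₗᵢ[ℝ] Rn n) (z : Rn n) :
    ‖firstMoment (ρ.map (similarityHomeomorph l hl.ne' O z))‖ = l * ‖firstMoment ρ‖ := by
  rw [firstMoment_map hρ hl, norm_smul, LinearIsometryEquiv.norm_map, Real.norm_of_nonneg hl.le]

theorem firstMoment_map_ne_zero (hρ : Admissible ρ) {S : Rn n → Rn n}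
    (hS : S ∈ similarities n) : firstMoment (ρ.map S) ≠ 0 := by
  obtain ⟨l, hl, O, z, rfl⟩ := exists_similarityHomeomorph hS
  rw [← norm_ne_zero_iff, norm_firstMoment_map hρ hl]
  exact mul_ne_zero hl.ne' (norm_ne_zero_iff.2 hρ.firstMoment_ne_zero)

theorem integral_map_similarity {S : Rn n → Rn n} (hS : S ∈ similarities n) (u : Rn n → ℝ) :
    ∫ᵛ x, u x ∂•(ρ.map S) = ∫ᵛ y, u (S y) ∂•ρ := by
  obtain ⟨l, hl, O, z, rfl⟩ := exists_similarityHomeomorph hS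
  exact (Homeomorph.measurableEmbedding _).integral_map_vectorMeasure

theorem continuous_of_mem_similarities {S : Rn n → Rn n} (hS : S ∈ similarities n) :
    Continuous S := by
  obtain ⟨l, hl, O, z, rfl⟩ := exists_similarityHomeomorph hS
  exact Homeomorph.continuous _

theorem id_mem_similarities : (id : Rn n → Rn n) ∈ similarities n :=
  ⟨1, LinearIsometryEquiv.refl ℝ _, 0, one_pos, fun y => by simp⟩

theorem integral_add_map (hρ : Admissible ρ) {S : Rn n → Rn n}
    (hS : S ∈ similarities n) {u v : Rn n → ℝ} (hu : Continuous u) (hv : Continuous v) :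
    ∫ᵛ x, (u x + v x) ∂•(ρ.map S) = ∫ᵛ x, u x ∂•(ρ.map S) + ∫ᵛ x, v x ∂•(ρ.map S) := by
  have hSc := continuous_of_mem_similarities hS
  rw [integral_map_similarity hS (fun x => u x + v x), integral_map_similarity hS,
    integral_map_similarity hS]
  exact VectorMeasure.integral_fun_add (hρ.integrable (hu.comp hSc)) (hρ.integrable (hv.comp hSc))

theorem integral_affine (hρ : Admissible ρ) {u : Rn n → ℝ} (hu : Continuous u) (c d : ℝ) :
    ∫ᵛ x, (c * u x + d) ∂•ρ = c * ∫ᵛ x, u x ∂•ρ := by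
  have h := VectorMeasure.integral_fun_smul ρ (ContinuousLinearMap.lsmul ℝ ℝ) c u
  simp only [smul_eq_mul] at h
  rw [VectorMeasure.integral_fun_add (hρ.integrable (by fun_prop)) (hρ.integrable (by fun_prop)),
    VectorMeasure.integral_const, hρ.mass_zero, h]
  simp

end SignedIntegral

/-! ### Extremals -/

section Extremal

variable {n : ℕ} {p : ℝ} {ρ : SignedMeasure (Rn n)}

theorem ofReal_le_rhoSeminorm {S : Rn n → Rn n} (hS : S ∈ similarities n) (u : Rn n → ℝ) :
    ENNReal.ofReal (|∫ᵛ x, u x ∂•(ρ.map S)| / ‖firstMoment (ρ.map S)‖ ^ (1 - (n : ℝ) / p)) ≤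
      rhoSeminorm p ρ u :=
  le_iSup₂ (f := fun S (_ : S ∈ similarities n) => ENNReal.ofReal
    (|∫ᵛ x, u x ∂•(ρ.map S)| / ‖firstMoment (ρ.map S)‖ ^ (1 - (n : ℝ) / p))) S hS

/-- The infimum is itself an admissible constant. Finiteness guarantees that some constant exists,
which matters when `gradNorm p u = 0`, since `⊤ * 0 = 0`. -/
theorem rhoSeminorm_le_bestConstant_mul (hC : bestConstant p ρ ≠ ⊤) {u : Rn n → ℝ}
    (hu : u ∈ homSobolev n p) : rhoSeminorm p ρ u ≤ bestConstant p ρ * gradNorm p u := by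
  have hne : {C | ∀ u ∈ homSobolev n p, rhoSeminorm p ρ u ≤ C * gradNorm p u}.Nonempty := by
    by_contra h
    rw [not_nonempty_iff_eq_empty] at h
    exact hC (by rw [bestConstant, h, sInf_empty])
  rw [bestConstant, sInf_eq_iInf', ENNReal.iInf_mul' (fun h => absurd h (gradNorm_ne_top hu))
    (fun _ => hne.to_subtype)]
  exact le_iInf fun C => C.2 u hu

theorem homSobolev_of_contDiff_hasCompactSupport {u : Rn n → ℝ} (hu : ContDiff ℝ 1 u)
    (hc : HasCompactSupport u) : u ∈ homSobolev n p :=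
  ⟨hu.continuous, _, hasWeakGradient_gradient hu,
    (continuous_gradient hu).memLp_of_hasCompactSupport (hasCompactSupport_gradient hc)⟩

/-- Test with `x ↦ ⟪m, x⟫`, `m` the first moment, cut off outside the support of `ρ`: its integral
is `‖m‖² > 0`, so its seminorm cannot vanish. -/
theorem bestConstant_ne_zero (hρ : Admissible ρ) : bestConstant p ρ ≠ 0 := by
  intro h0
  obtain ⟨R, hR⟩ := hρ.isCompact_support.isBounded.subset_closedBall (0 : Rn n)
  let φ : ContDiffBump (0 : Rn n) := ⟨|R| + 1, |R| + 2, by positivity, by linarith⟩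
  let L : Rn n →L[ℝ] ℝ := innerSL ℝ (firstMoment ρ)
  have hf : ContDiff ℝ 1 (fun x => φ x * L x) := φ.contDiff.mul L.contDiff
  have hmem : (fun x => φ x * L x) ∈ homSobolev n p :=
    homSobolev_of_contDiff_hasCompactSupport hf φ.hasCompactSupport.mul_right
  have hint : ∫ᵛ x, φ x * L x ∂•ρ = ‖firstMoment ρ‖ ^ 2 := by
    have h1 : ∫ᵛ x, φ x * L x ∂•ρ = ∫ᵛ x, L x ∂•ρ := by
      refine VectorMeasure.integral_congr_ae ?_
      filter_upwards [ae_mem_support_totalVariation ρ] with x hx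
      have h2 : x ∈ Metric.closedBall (0 : Rn n) φ.rIn :=
        Metric.closedBall_subset_closedBall
          (show R ≤ |R| + 1 by linarith [le_abs_self R]) (hR hx)
      rw [φ.one_of_mem_closedBall h2, one_mul]
    rw [h1, ← integral_smul_flip_eq,
      integral_clm_comp_signedMeasure ρ (f := fun x => x) (hρ.integrable continuous_id) L]
    exact real_inner_self_eq_norm_sq (firstMoment ρ)
  have h1 := ofReal_le_rhoSeminorm (p := p) (ρ := ρ) id_mem_similarities (fun x => φ x * L x)
  have h2 := rhoSeminorm_le_bestConstant_mul (p := p) (ρ := ρ) (by simp [h0]) hmem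
  rw [h0, zero_mul] at h2
  have h3 := h1.trans h2
  rw [VectorMeasure.map_id, hint, nonpos_iff_eq_zero, ENNReal.ofReal_eq_zero] at h3
  have hpos : 0 < ‖firstMoment ρ‖ := norm_pos_iff.2 hρ.firstMoment_ne_zero
  exact absurd h3 (not_le.2 (by positivity))

/-- Two functions of the homogeneous Sobolev space with the same integral against `S_# ρ`, for both
of which the generalized Morrey inequality is attained at `S`, differ by a constant. -/
theorem exists_const_of_attained (hp : 1 < p) (hρ : Admissible ρ) {S : Rn n → Rn n}
    (hS : S ∈ similarities n) {u₁ u₂ : Rn n → ℝ} (h₁ : u₁ ∈ homSobolev n p)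
    (h₂ : u₂ ∈ homSobolev n p)
    (hint : ∫ᵛ x, u₁ x ∂•(ρ.map S) = ∫ᵛ x, u₂ x ∂•(ρ.map S))
    (e₁ : bestConstant p ρ * gradNorm p u₁ = ENNReal.ofReal
      (|∫ᵛ x, u₁ x ∂•(ρ.map S)| / ‖firstMoment (ρ.map S)‖ ^ (1 - (n : ℝ) / p)))
    (e₂ : bestConstant p ρ * gradNorm p u₂ = ENNReal.ofReal
      (|∫ᵛ x, u₂ x ∂•(ρ.map S)| / ‖firstMoment (ρ.map S)‖ ^ (1 - (n : ℝ) / p))) :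
    ∃ c : ℝ, ∀ x, u₁ x - u₂ x = c := by
  have hC0 : bestConstant p ρ ≠ 0 := bestConstant_ne_zero hρ
  obtain ⟨c₁, g₁, hg₁, m₁⟩ := id h₁
  obtain ⟨c₂, g₂, hg₂, m₂⟩ := id h₂
  refine exists_const_of_hasWeakGradient c₁ c₂ hg₁ hg₂ ?_
  by_cases hC : bestConstant p ρ = ⊤
  -- If `C_* = ∞`, the attained values are still finite, so both gradients vanish.
  · have hz : ∀ {u : Rn n → ℝ} {g : Rn n → Rn n} {r : ℝ}, HasWeakGradient u g →
        bestConstant p ρ * gradNorm p u = ENNReal.ofReal r → g =ᵐ[volume] 0 := by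
      intro u g r hg he
      have h0 : gradNorm p u = 0 := by
        by_contra hne
        rw [hC, ENNReal.top_mul hne] at he
        exact ENNReal.ofReal_ne_top he.symm
      rw [gradNorm_eq hg] at h0
      exact (eLpNorm_eq_zero_iff hg.2.1.aestronglyMeasurable
        (by simpa using (by linarith : 0 < p))).1 h0
    exact (hz hg₁ e₁).trans (hz hg₂ e₂).symm
  · have hw : (fun x => u₁ x + u₂ x) ∈ homSobolev n p :=
      ⟨c₁.add c₂, _, hg₁.add hg₂, m₁.add m₂⟩
    have hle := (ofReal_le_rhoSeminorm (p := p) hS (fun x => u₁ x + u₂ x)).trans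
      (rhoSeminorm_le_bestConstant_mul hC hw)
    rw [integral_add_map hρ hS c₁ c₂, ← hint, ← two_mul, abs_mul, abs_two, mul_div_assoc,
      ENNReal.ofReal_mul zero_le_two, ← e₁, gradNorm_eq (hg₁.add hg₂), gradNorm_eq hg₁,
      ENNReal.ofReal_ofNat, mul_left_comm, ENNReal.mul_le_mul_iff_right hC0 hC] at hle
    rw [hint, ← e₂, ENNReal.mul_right_inj hC0 hC, gradNorm_eq hg₁, gradNorm_eq hg₂] at e₁
    exact ae_eq_of_eLpNorm_add_ge hp m₁ m₂ e₁ hle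

/-- Strict convexity needs `p > 1`; dimension zero is excluded because a nonzero first moment cannot
exist there. -/
theorem one_lt_of_admissible (hρ : Admissible ρ) (hp : (n : ℝ) < p) : 1 < p := by
  have hn : 1 ≤ n := by
    by_contra h
    obtain rfl : n = 0 := by omega
    exact hρ.firstMoment_ne_zero (Subsingleton.elim _ _)
  exact lt_of_le_of_lt (by exact_mod_cast hn) hp

end Extremal

theorem mainTheorem5 (n : ℕ) (p : ℝ) (hp : (n : ℝ) < p)
    (ρ : SignedMeasure (Rn n)) (hρ : Admissible ρ)
    (S : Rn n → Rn n) (hS : S ∈ similarities n)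
    (μ : SignedMeasure (Rn n)) (hμ : μ = ρ.map S) :
    (∀ u v : Rn n → ℝ, IsExtremal p ρ u → IsExtremal p ρ v →
      rhoSeminorm p ρ u =
        ENNReal.ofReal ((∫ᵛ x, u x ∂•μ) / ‖firstMoment μ‖ ^ (1 - (n : ℝ) / p)) →
      0 < (∫ᵛ x, u x ∂•μ) / ‖firstMoment μ‖ ^ (1 - (n : ℝ) / p) →
      rhoSeminorm p ρ v =
        ENNReal.ofReal ((∫ᵛ y, v y ∂•ρ) / ‖firstMoment ρ‖ ^ (1 - (n : ℝ) / p)) →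
      0 < (∫ᵛ y, v y ∂•ρ) / ‖firstMoment ρ‖ ^ (1 - (n : ℝ) / p) →
      ∀ y, v y = (∫ᵛ x, v x ∂•ρ) / (∫ᵛ x, u x ∂•μ) * (u (S y) - u (S 0)) + v 0) ∧
    (∀ u₁ u₂ : Rn n → ℝ, IsExtremal p ρ u₁ → IsExtremal p ρ u₂ →
      rhoSeminorm p ρ u₁ =
        ENNReal.ofReal (|∫ᵛ x, u₁ x ∂•μ| / ‖firstMoment μ‖ ^ (1 - (n : ℝ) / p)) →
      rhoSeminorm p ρ u₂ =
        ENNReal.ofReal (|∫ᵛ x, u₂ x ∂•μ| / ‖firstMoment μ‖ ^ (1 - (n : ℝ) / p)) →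
      (∫ᵛ x, u₁ x ∂•μ) = ∫ᵛ x, u₂ x ∂•μ →
      ∃ c : ℝ, ∀ x, u₁ x - u₂ x = c) := by
  subst hμ
  have hp1 : 1 < p := one_lt_of_admissible hρ hp
  refine ⟨fun u v hu hv eu pu ev pv y => ?_, fun u₁ u₂ h₁ h₂ e₁ e₂ hint =>
    exists_const_of_attained hp1 hρ hS h₁.1 h₂.1 hint (h₁.2 ▸ e₁) (h₂.2 ▸ e₂)⟩
  have hSu := integral_map_similarity (ρ := ρ) hS u
  have hMS : 0 < ‖firstMoment (ρ.map S)‖ := norm_pos_iff.2 (firstMoment_map_ne_zero hρ hS)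
  have hM : 0 < ‖firstMoment ρ‖ := norm_pos_iff.2 hρ.firstMoment_ne_zero
  rw [div_pos_iff_of_pos_right (by positivity)] at pu pv
  set α : ℝ := 1 - (n : ℝ) / p with hα
  set U := ∫ᵛ x, u x ∂•(ρ.map S) with hU
  set V := ∫ᵛ x, v x ∂•ρ with hV
  set c := V / U with hc
  have hc0 : 0 < c := div_pos pv pu
  obtain ⟨l, hl, O, z, rfl⟩ := exists_similarityHomeomorph hS
  set T := similarityHomeomorph l hl.ne' O z
  obtain ⟨m1, G1⟩ := homSobolev_comp_similarityHomeomorph (by linarith) hu.1 hl O z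
  -- The factor `c = V / U` matches the integral of `v`; the additive constant matches its value at
  -- `0`.
  obtain ⟨m2, G2⟩ := homSobolev_affine m1 hc0.le (v 0 - c * u (T 0))
  have hw : ∫ᵛ y, (c * u (T y) + (v 0 - c * u (T 0))) ∂•ρ = V := by
    rw [integral_affine hρ m1.1, ← hSu, hc, div_mul_cancel₀ _ pu.ne']
  -- The factor `l ^ α` from the gradient norm cancels the one from the first moment of `S_# ρ`, so
  -- the rescaled function attains the supremum at `ρ`.
  have hGw : bestConstant p ρ * gradNorm p (fun y => c * u (T y) + (v 0 - c * u (T 0))) =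
      ENNReal.ofReal (V / ‖firstMoment ρ‖ ^ α) := by
    rw [G2, G1, mul_left_comm, mul_left_comm (bestConstant p ρ), ← hu.2, eu,
      norm_firstMoment_map hρ hl, ← ENNReal.ofReal_mul (by positivity),
      ← ENNReal.ofReal_mul hc0.le, Real.mul_rpow hl.le hM.le]
    congr 1
    rw [hc, ← hα]
    have hlα : l ^ α ≠ 0 := by positivity
    generalize l ^ α = a at hlα
    field_simp
  obtain ⟨d, hd⟩ := exists_const_of_attained (S := id) hp1 hρ id_mem_similarities hv.1 m2
    (by rw [VectorMeasure.map_id]; exact hw.symm)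
    (by rw [VectorMeasure.map_id, ← hv.2, ev, abs_of_pos pv])
    (by rw [VectorMeasure.map_id, hGw, hw, abs_of_pos pv])
  -- Evaluation at `0` shows that the constant `d` is zero.
  have h0 := hd 0
  have hy := hd y
  linarith
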